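/- There is an absolute constant $\gamma>0$ with the following properties. Let $\{-1,1\}^n$ carry the uniform probability measure, and call a complex-valued function on a product $X_1\times\dots\times X_n$ 1-Lipschitz if it is 1-Lipschitz in the Hamming metric, where the distance of two points is the number of coordinates in which they differ. (a) For all sufficiently large $n$ there is a 1-Lipschitz function $\phi:\{-1,1\}^n\to\mathbb{C}$ with $\mathbf{E}\,e^{\lambda\phi}=0$ for some $\lambda\in\mathbb{C}$ with $|\lambda|\le \gamma/\sqrt{n}$. Moreover, with the same $\phi$, for every integer $k\ge 1$ the sum $f_k=\phi+\dots+\phi$ of $k$ copies of $\phi$ (a family of $k$ 1-Lipschitz functions, each depending on at most $r=n$ coordinates, with at most $c=k$ of them depending on any given coordinate) satisfies $\mathbf{E}\,e^{\lambda f_k}=0$ for some $\lambda\in\mathbb{C}$ with $|\lambda|\le \gamma/(k\sqrt{n})=\gamma/(c\sqrt r)$. (b) Consequently the bound $|\lambda|\le \frac{1}{3c\sqrt{r-1}}$ in the zero-freeness theorem is sharp up to an absolute constant factor. That theorem says that, for integers $c\ge1$ and $r\ge2$, if $f=\phi_1+\dots+\phi_m$, where $\phi_1,\dots,\phi_m$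 are measurable 1-Lipschitz complex-valued functions on a product $X_1\times\dots\times X_n$ of probability spaces, each depending on at most $r$ coordinates and at most $c$ of them depending on any given coordinate, then $\mathbf{E}\,e^{\lambda f}\neq 0$ whenever $|\lambda|\le \frac{1}{3c\sqrt{r-1}}$. Sharpness means: for all integers $c\ge 1$ and $r\ge 2$ there are such $n$, $m$, probability spaces $X_1,\dots,X_n$, functions $\phi_1,\dots,\phi_m$ and a complex $\lambda$ with $|\lambda|\le \frac{\gamma}{c\sqrt{r-1}}$ for which $\mathbf{E}\,e^{\lambda f}=0$. (The zero-freeness theorem itself is not part of the present claim.) -/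

import Mathlib

/-- A complex-valued function on a finite product is 1-Lipschitz in the Hamming metric, where
`hammingDist x y` is the number of coordinates in which `x` and `y` differ. -/
def HammingLipschitz {n : ℕ} {X : Fin n → Type*} (φ : (∀ j, X j) → ℂ) : Prop :=
  open Classical in ∀ x y : ∀ j, X j, ‖φ x - φ y‖ ≤ (hammingDist x y : ℝ)

/-- A family `φ 0, …, φ (m - 1)` of measurable functions on a product of `n` measurable spaces
such that each is 1-Lipschitz in the Hamming metric, each depends on at most `r` coordinates, and
at most `c` of them depend on any given coordinate. -/
structure IsAdmissible {n m : ℕ} {X : Fin n → Type*} [∀ j, MeasurableSpace (X j)]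
    (φ : Fin m → (∀ j, X j) → ℂ) (c r : ℕ) : Prop where
  measurable : ∀ i, Measurable (φ i)
  lipschitz : ∀ i, HammingLipschitz (φ i)
  dependence : ∃ J : Fin m → Finset (Fin n),
    (∀ i, (J i).card ≤ r) ∧
    (∀ i, ∀ x y : ∀ j, X j, (∀ j ∈ J i, x j = y j) → φ i x = φ i y) ∧
    (∀ j, (Finset.univ.filter fun i => j ∈ J i).card ≤ c)

/-- The disc `|z| ≤ ρ` is zero-free for `z ↦ 𝐄 exp (z (φ₁ + ⋯ + φₘ))`, for every admissible family
with parameters `c`, `r` on every finite product of probability spaces. (The integrand is bounded,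
since a Hamming-Lipschitz function on a finite product is bounded.) -/
def ZeroFreeRadius (c r : ℕ) (ρ : ℝ) : Prop :=
  ∀ (n m : ℕ) (X : Fin n → Type) [∀ j, MeasurableSpace (X j)]
    (μ : ∀ j, MeasureTheory.Measure (X j)) [∀ j, MeasureTheory.IsProbabilityMeasure (μ j)]
    (φ : Fin m → (∀ j, X j) → ℂ), IsAdmissible φ c r →
    ∀ z : ℂ, ‖z‖ ≤ ρ →
      ∫ x, Complex.exp (z * ∑ i, φ i x) ∂(MeasureTheory.Measure.pi μ) ≠ 0

/-- The two-point space `{-1, 1}`, with its discrete measurable structure. -/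
abbrev PlusMinus : Type := ↥({-1, 1} : Finset ℤ)

/-- The uniform probability measure on the cube `{-1, 1}ⁿ`, as the product of the uniform
probability measures on the factors. -/
noncomputable def cubeMeasure (n : ℕ) : MeasureTheory.Measure (Fin n → PlusMinus) :=
  MeasureTheory.Measure.pi fun _ => ProbabilityTheory.uniformOn (Set.univ : Set PlusMinus)

/-! Let `S` be half the sum of the coordinates and `φ` its truncation to `[-b, b]` with `b = √n /
8`; both are 1-Lipschitz and odd. Oddness makes `𝐄 exp (i t φ) = 𝐄 cos (t φ)` real. It is `1` at `t
= 0`. At `t = π / b` the cosine is `-1` wherever `|φ| = b`, an event of probability at least `1/2`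
by `two_mul_card_abs_halfSum_lt_le`, so the mean is at most `0`. Continuity gives a zero with `t ≤
8π / √n` (`exists_sum_cos_eq_zero`). For `k` copies of `φ`, `λ = i t / k` gives the same integral.
Sharpness follows with `n = r` and `c` copies. -/

open Finset in
/-- The symmetry `x ↦ -x` of the two-point space. -/
def PlusMinus.neg (x : PlusMinus) : PlusMinus :=
  ⟨-x.1, by rcases x with ⟨x, hx⟩; simp only [mem_insert, mem_singleton] at hx ⊢; omega⟩

theorem PlusMinus.neg_neg (x : PlusMinus) : x.neg.neg = x := by
  simp [PlusMinus.neg]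

theorem PlusMinus.val_eq (x : PlusMinus) : x.1 = -1 ∨ x.1 = 1 := by
  simpa only [Finset.mem_insert, Finset.mem_singleton] using x.2

theorem PlusMinus.card_eq : Fintype.card PlusMinus = 2 := by
  simp [PlusMinus]

/-! ### Central binomial bounds -/

/-- The factor `3 * m + 1` makes the induction close; the factor `2 * m` needed later would not. -/
theorem three_mul_add_one_mul_centralBinom_sq_le (m : ℕ) :
    (3 * m + 1) * m.centralBinom ^ 2 ≤ 16 ^ m := by
  induction m with
  | zero => simp
  | succ m ih =>
    have h := Nat.succ_mul_centralBinom_succ m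
    have h2 : (m + 1) ^ 2 * (m + 1).centralBinom ^ 2
        = 4 * (2 * m + 1) ^ 2 * m.centralBinom ^ 2 := by
      rw [← mul_pow, h]; ring
    have hp : 0 < (m + 1) ^ 2 := by positivity
    refine Nat.le_of_mul_le_mul_left (?_ : (m + 1) ^ 2 * _ ≤ (m + 1) ^ 2 * _) hp
    calc (m + 1) ^ 2 * ((3 * (m + 1) + 1) * (m + 1).centralBinom ^ 2)
        = (3 * m + 4) * ((m + 1) ^ 2 * (m + 1).centralBinom ^ 2) := by ring
      _ = (4 * ((3 * m + 4) * (2 * m + 1) ^ 2)) * m.centralBinom ^ 2 := by rw [h2]; ring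
      _ ≤ (16 * (m + 1) ^ 2 * (3 * m + 1)) * m.centralBinom ^ 2 := by
        gcongr ?_ * _
        nlinarith
      _ = 16 * (m + 1) ^ 2 * ((3 * m + 1) * m.centralBinom ^ 2) := by ring
      _ ≤ 16 * (m + 1) ^ 2 * 16 ^ m := by gcongr
      _ = (m + 1) ^ 2 * 16 ^ (m + 1) := by ring

theorem mul_choose_half_sq_le (n : ℕ) : n * n.choose (n / 2) ^ 2 ≤ 4 ^ n := by
  obtain ⟨m, rfl | rfl⟩ := n.even_or_odd'
  · have h := three_mul_add_one_mul_centralBinom_sq_le m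
    rw [Nat.centralBinom] at h
    rw [Nat.mul_div_cancel_left m two_pos, pow_mul]
    refine le_trans ?_ h
    gcongr
    omega
  -- For odd `n` the middle coefficient is half of the next central one.
  · have h := three_mul_add_one_mul_centralBinom_sq_le (m + 1)
    have hc : (m + 1).centralBinom = 2 * (2 * m + 1).choose m := by
      rw [Nat.centralBinom, show 2 * (m + 1) = 2 * m + 1 + 1 by ring, Nat.choose_succ_succ,
        Nat.choose_symm_half]
      ring
    rw [show (2 * m + 1) / 2 = m by omega]
    rw [hc] at h
    have e : (4 : ℕ) ^ (2 * m + 1) = 4 * 16 ^ m := by rw [pow_succ, pow_mul]; norm_num [mul_comm]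
    rw [e]
    rw [pow_succ 16, mul_pow] at h
    nlinarith [Nat.zero_le ((2 * m + 1).choose m ^ 2), Nat.zero_le (m * (2 * m + 1).choose m ^ 2)]

theorem choose_mul_sqrt_le (n k : ℕ) : (n.choose k : ℝ) * √n ≤ 2 ^ n := by
  have h1 : (n.choose k : ℝ) ≤ n.choose (n / 2) := by exact_mod_cast Nat.choose_le_middle k n
  have h2 : (n : ℝ) * (n.choose (n / 2) : ℝ) ^ 2 ≤ 4 ^ n := by
    exact_mod_cast mul_choose_half_sq_le n
  calc (n.choose k : ℝ) * √n ≤ n.choose (n / 2) * √n := by gcongr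
    _ ≤ 2 ^ n := by
      refine abs_le_of_sq_le_sq' ?_ (by positivity) |>.2
      rw [mul_pow, Real.sq_sqrt (by positivity), ← pow_mul, mul_comm n 2, pow_mul]
      norm_num
      linarith

/-! ### Anticoncentration of the half-sum -/

/-- The number of coordinates equal to `1`. -/
def plusCount {n : ℕ} (x : Fin n → PlusMinus) : ℕ :=
  (Finset.univ.filter fun i => (x i).1 = 1).card

/-- Half the sum of the coordinates. -/
noncomputable def halfSum {n : ℕ} (x : Fin n → PlusMinus) : ℝ :=
  ∑ i, ((x i).1 : ℝ) / 2

theorem halfSum_eq {n : ℕ} (x : Fin n → PlusMinus) : halfSum x = plusCount x - n / 2 := by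
  have h : ∀ i, ((x i).1 : ℝ) / 2 = (if (x i).1 = 1 then 1 else 0) - 1 / 2 := by
    intro i
    rcases (x i).val_eq with h | h <;> rw [h] <;> norm_num
  simp only [halfSum, h, Finset.sum_sub_distrib, plusCount, Finset.card_filter]
  push_cast
  simp
  ring

theorem halfSum_neg {n : ℕ} (x : Fin n → PlusMinus) :
    halfSum (fun i => (x i).neg) = -halfSum x := by
  simp [halfSum, PlusMinus.neg, neg_div]

theorem abs_halfSum_sub_le {n : ℕ} (x y : Fin n → PlusMinus) :
    |halfSum x - halfSum y| ≤ hammingDist x y := by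
  rw [halfSum, halfSum, ← Finset.sum_sub_distrib, hammingDist, Finset.card_filter]
  push_cast
  refine (Finset.abs_sum_le_sum_abs _ _).trans (Finset.sum_le_sum fun i _ => ?_)
  by_cases h : x i = y i
  · simp [h]
  · rw [if_pos h]
    rcases (x i).val_eq with h1 | h1 <;> rcases (y i).val_eq with h2 | h2 <;> rw [h1, h2] <;>
      norm_num

theorem card_plusCount_eq_le (n k : ℕ) :
    (Finset.univ.filter fun x : Fin n → PlusMinus => plusCount x = k).card ≤ n.choose k := by
  have h : ((Finset.univ : Finset (Fin n)).powersetCard k).card = n.choose k := by simp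
  rw [← h]
  refine Finset.card_le_card_of_injOn (fun x => Finset.univ.filter fun i => (x i).1 = 1) ?_ ?_
  · intro x hx
    have hx : plusCount x = k := (Finset.mem_filter.mp hx).2
    exact Finset.mem_powersetCard.mpr ⟨Finset.subset_univ _, hx⟩
  · intro x _ y _ hxy
    funext i
    have hi : (x i).1 = 1 ↔ (y i).1 = 1 := by
      simpa using Finset.ext_iff.mp hxy i
    apply Subtype.ext
    rcases (x i).val_eq with h1 | h1 <;> rcases (y i).val_eq with h2 | h2 <;> simp_all

theorem card_filter_abs_sub_lt_le (s : Finset ℕ) (a b : ℝ) (hb : 0 ≤ b) :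
    ((s.filter fun k : ℕ => |(k : ℝ) - a| < b).card : ℝ) ≤ 2 * b + 1 := by
  have h1 : (s.filter fun k : ℕ => |(k : ℝ) - a| < b).card ≤ (Finset.Icc ⌈a - b⌉ ⌊a + b⌋).card := by
    refine Finset.card_le_card_of_injOn (fun k : ℕ => (k : ℤ)) ?_ (by intro x _ y _ h; simpa using h)
    intro k hk
    have hk : k ∈ s ∧ |(k : ℝ) - a| < b := by simpa using hk
    have := abs_lt.mp hk.2
    simp only [Finset.coe_Icc, Set.mem_Icc, Int.ceil_le, Int.le_floor, Int.cast_natCast]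
    constructor <;> linarith
  rw [Int.card_Icc] at h1
  have h2 : (((⌊a + b⌋ + 1 - ⌈a - b⌉).toNat : ℤ) : ℝ) ≤ 2 * b + 1 := by
    rw [Int.toNat_eq_max]
    push_cast
    refine max_le ?_ (by linarith)
    have := Int.floor_le (a + b)
    have := Int.le_ceil (a - b)
    linarith
  have h3 : ((s.filter fun k : ℕ => |(k : ℝ) - a| < b).card : ℝ)
      ≤ ((⌊a + b⌋ + 1 - ⌈a - b⌉).toNat : ℝ) := by exact_mod_cast h1
  refine h3.trans ?_
  exact_mod_cast h2

/-- Anticoncentration of the sum of the coordinates on the cube. -/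
theorem two_mul_card_abs_halfSum_lt_le {n : ℕ} (hn : 16 ≤ n) :
    2 * (Finset.univ.filter fun x : Fin n → PlusMinus => |halfSum x| < √n / 8).card ≤ 2 ^ n := by
  set A := Finset.univ.filter fun x : Fin n → PlusMinus => |halfSum x| < √n / 8
  set K := (Finset.range (n + 1)).filter fun k : ℕ => |(k : ℝ) - n / 2| < √n / 8
  -- This absorbs the `+ 1` in the count of levels: `√n / 4 + 1 ≤ √n / 2`.
  have hs : (4 : ℝ) ≤ √n := by
    rw [show (4 : ℝ) = √16 by rw [show (16 : ℝ) = 4 ^ 2 by norm_num]; simp]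
    exact Real.sqrt_le_sqrt (by exact_mod_cast hn)
  have hmaps : ∀ x ∈ A, plusCount x ∈ K := by
    intro x hx
    have hx : |halfSum x| < √n / 8 := by simpa [A] using hx
    rw [halfSum_eq] at hx
    have : plusCount x ≤ n := (Finset.card_le_univ _).trans (by simp)
    simp only [K, Finset.mem_filter, Finset.mem_range]
    exact ⟨by omega, hx⟩
  have hA : (A.card : ℝ) ≤ ∑ k ∈ K, (n.choose k : ℝ) := by
    rw [Finset.card_eq_sum_card_fiberwise hmaps]
    push_cast
    refine Finset.sum_le_sum fun k _ => ?_
    have := (Finset.card_le_card (Finset.filter_subset_filter (fun x => plusCount x = k)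
      (Finset.subset_univ A))).trans (card_plusCount_eq_le n k)
    exact_mod_cast this
  have hK : (K.card : ℝ) ≤ √n / 2 := by
    have := card_filter_abs_sub_lt_le (Finset.range (n + 1)) (n / 2) (√n / 8) (by positivity)
    linarith
  -- At most `√n / 2` levels, each of probability at most `1 / √n`.
  have hsum : (∑ k ∈ K, (n.choose k : ℝ)) * √n ≤ √n / 2 * 2 ^ n := by
    rw [Finset.sum_mul]
    refine (Finset.sum_le_card_nsmul K _ (2 ^ n) fun k _ => choose_mul_sqrt_le n k).trans ?_
    rw [nsmul_eq_mul]
    gcongr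
  have h : (2 * A.card : ℝ) ≤ 2 ^ n := by
    have hpos : 0 < √(n : ℝ) := by linarith
    refine le_of_mul_le_mul_right ?_ hpos
    nlinarith
  exact_mod_cast h

/-! ### Zeros from a sign change -/

theorem sum_cexp_I_mul_eq_zero_of_odd {α : Type*} [Fintype α] (e : α ≃ α) (g : α → ℝ)
    (hg : ∀ x, g (e x) = -g x) (t : ℝ) (ht : ∑ x, Real.cos (t * g x) = 0) :
    ∑ x, Complex.exp (t * Complex.I * g x) = 0 := by
  have hsin : ∑ x, Real.sin (t * g x) = 0 := by
    have h := Equiv.sum_comp e fun x => Real.sin (t * g x)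
    simp only [hg, mul_neg, Real.sin_neg, Finset.sum_neg_distrib] at h
    linarith
  have h : ∀ x, Complex.exp (t * Complex.I * g x)
      = (Real.cos (t * g x) : ℂ) + (Real.sin (t * g x) : ℂ) * Complex.I := by
    intro x
    rw [show (t : ℂ) * Complex.I * g x = ((t * g x : ℝ) : ℂ) * Complex.I by push_cast; ring,
      Complex.exp_mul_I, Complex.ofReal_cos, Complex.ofReal_sin]
  simp only [h, Finset.sum_add_distrib, ← Finset.sum_mul, ← Complex.ofReal_sum, ht, hsin]
  simp

/-- If `|g| ≤ b` with equality on at least half of the points, the average of `cos (t g)` changes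
sign for `t` between `0` and `π / b`. -/
theorem exists_sum_cos_eq_zero {α : Type*} [Fintype α] (g : α → ℝ) (b : ℝ) (hb : 0 < b)
    (hg : ∀ x, |g x| ≤ b)
    (hcard : 2 * (Finset.univ.filter fun x => |g x| < b).card ≤ Fintype.card α) :
    ∃ t : ℝ, 0 ≤ t ∧ t ≤ Real.pi / b ∧ ∑ x, Real.cos (t * g x) = 0 := by
  have hcont : Continuous fun t : ℝ => ∑ x, Real.cos (t * g x) := by fun_prop
  have hle : ∑ x, Real.cos (Real.pi / b * g x) ≤ 0 := by
    have hx : ∀ x, Real.cos (Real.pi / b * g x) ≤ 2 * (if |g x| < b then 1 else 0) - 1 := by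
      intro x
      split_ifs with h
      · linarith [Real.cos_le_one (Real.pi / b * g x)]
      · have habs : |Real.pi / b * g x| = Real.pi := by
          rw [abs_mul, le_antisymm (hg x) (not_lt.mp h), abs_of_pos (by positivity)]
          field_simp
        rw [← Real.cos_abs, habs, Real.cos_pi]
        norm_num
    refine (Finset.sum_le_sum fun x _ => hx x).trans ?_
    rw [Finset.sum_sub_distrib, ← Finset.mul_sum, Finset.sum_boole]
    have : (2 * (Finset.univ.filter fun x => |g x| < b).card : ℝ) ≤ Fintype.card α := by
      exact_mod_cast hcard
    simpa using this
  have h0 : 0 ≤ ∑ x, Real.cos (0 * g x) := by simp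
  obtain ⟨t, ht, h⟩ := intermediate_value_Icc' (show (0 : ℝ) ≤ Real.pi / b by positivity)
    hcont.continuousOn ⟨hle, h0⟩
  exact ⟨t, ht.1, ht.2, h⟩

/-! ### Truncation -/

/-- The truncation of `s` to `[-b, b]`. -/
noncomputable def clamp (b s : ℝ) : ℝ := max (-b) (min b s)

theorem abs_clamp_le {b : ℝ} (hb : 0 ≤ b) (s : ℝ) : |clamp b s| ≤ b := by
  rw [clamp, abs_le]
  exact ⟨le_max_left _ _, max_le (by linarith) (min_le_left _ _)⟩

theorem clamp_neg {b : ℝ} (hb : 0 ≤ b) (s : ℝ) : clamp b (-s) = -clamp b s := by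
  unfold clamp
  grind

/-- Transfers anticoncentration from the half-sum to its truncation. -/
theorem abs_lt_of_abs_clamp_lt {b s : ℝ} (h : |clamp b s| < b) : |s| < b := by
  unfold clamp at h
  rw [abs_lt] at h ⊢
  grind

theorem abs_clamp_sub_le (b s t : ℝ) : |clamp b s - clamp b t| ≤ |s - t| := by
  unfold clamp
  refine (abs_max_sub_max_le_max _ _ _ _).trans (max_le (by simp) ?_)
  exact (abs_min_sub_min_le_max _ _ _ _).trans (max_le (by simp) le_rfl)

/-! ### Integrals on the cube and assembly -/

theorem cubeMeasure_real_singleton (n : ℕ) (x : Fin n → PlusMinus) :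
    (cubeMeasure n).real {x} = (1 / 2) ^ n := by
  have h : ∀ y : PlusMinus,
      ProbabilityTheory.uniformOn (Set.univ : Set PlusMinus) {y} = 1 / 2 := by
    intro y
    rw [ProbabilityTheory.uniformOn_univ, MeasureTheory.Measure.count_singleton,
      PlusMinus.card_eq]
    simp
  have : MeasureTheory.IsProbabilityMeasure
      (ProbabilityTheory.uniformOn (Set.univ : Set PlusMinus)) :=
    ProbabilityTheory.isProbabilityMeasure_uniformOn Set.finite_univ
      ⟨⟨1, by simp⟩, Set.mem_univ _⟩
  rw [MeasureTheory.measureReal_def, cubeMeasure, MeasureTheory.Measure.pi_singleton]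
  simp [h]

theorem integral_cubeMeasure_eq_zero {n : ℕ} (f : (Fin n → PlusMinus) → ℂ) (hf : ∑ x, f x = 0) :
    ∫ x, f x ∂(cubeMeasure n) = 0 := by
  by_cases hi : MeasureTheory.Integrable f (cubeMeasure n)
  · rw [MeasureTheory.integral_fintype hi]
    simp only [cubeMeasure_real_singleton, ← Finset.smul_sum, hf, smul_zero]
  -- The integral has default value `0`, so integrability need not be shown.
  · exact MeasureTheory.integral_undef hi

theorem isAdmissible_const {n k : ℕ} {φ : (Fin n → PlusMinus) → ℂ} (h : HammingLipschitz φ) :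
    IsAdmissible (fun _ : Fin k => φ) k n where
  measurable _ := measurable_of_countable φ
  lipschitz _ := h
  dependence := by
    refine ⟨fun _ => Finset.univ, by simp, ?_, by simp⟩
    intro _ x y hxy
    rw [funext fun j => hxy j (Finset.mem_univ j)]

theorem exists_real_lipschitz_sum_cos_eq_zero {n : ℕ} (hn : 1 ≤ n) :
    ∃ g : (Fin n → PlusMinus) → ℝ, (∀ x y, |g x - g y| ≤ hammingDist x y) ∧
      (∀ x, g (fun i => (x i).neg) = -g x) ∧
      ∃ t : ℝ, 0 ≤ t ∧ t ≤ 8 * Real.pi / √n ∧ ∑ x, Real.cos (t * g x) = 0 := by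
  have hcardα : Fintype.card (Fin n → PlusMinus) = 2 ^ n := by
    rw [Fintype.card_fun, PlusMinus.card_eq, Fintype.card_fin]
  have hpos : 0 < √(n : ℝ) := Real.sqrt_pos.mpr (by exact_mod_cast hn)
  by_cases h : 16 ≤ n
  · have hb : 0 < √(n : ℝ) / 8 := by positivity
    refine ⟨fun x => clamp (√n / 8) (halfSum x),
      fun x y => (abs_clamp_sub_le _ _ _).trans (abs_halfSum_sub_le x y),
      fun x => by simp only [halfSum_neg, clamp_neg hb.le], ?_⟩
    obtain ⟨t, h0, h1, ht⟩ := exists_sum_cos_eq_zero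
      (fun x : Fin n → PlusMinus => clamp (√n / 8) (halfSum x)) _ hb
      (fun x => abs_clamp_le hb.le _) (by
        rw [hcardα]
        refine le_trans ?_ (two_mul_card_abs_halfSum_lt_le h)
        exact Nat.mul_le_mul_left 2 (Finset.card_le_card
          (Finset.monotone_filter_right _ fun x _ => abs_lt_of_abs_clamp_lt)))
    refine ⟨t, h0, h1.trans_eq ?_, ht⟩
    field_simp
  -- Sharpness is claimed for every `r ≥ 2`, so small `n` matter too. One coordinate suffices: `t ≤
  -- 2π ≤ 8π / √n` since `√n ≤ 4`.
  · have habs : ∀ y : PlusMinus, |(y.1 : ℝ) / 2| = 1 / 2 := by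
      intro y
      rcases y.val_eq with h | h <;> rw [h] <;> norm_num [abs_of_pos, abs_of_neg]
    refine ⟨fun x => ((x ⟨0, hn⟩).1 : ℝ) / 2, fun x y => ?_,
      fun x => by simp [PlusMinus.neg, neg_div], ?_⟩
    · by_cases hxy : x ⟨0, hn⟩ = y ⟨0, hn⟩
      · simp [hxy]
      · have h1 : 1 ≤ hammingDist x y :=
          Nat.one_le_iff_ne_zero.mpr (hammingDist_ne_zero.mpr fun e => hxy (by rw [e]))
        have h2 : (1 : ℝ) ≤ hammingDist x y := by exact_mod_cast h1
        refine (abs_sub _ _).trans ?_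
        rw [habs, habs]
        linarith
    · obtain ⟨t, h0, h1, ht⟩ := exists_sum_cos_eq_zero
        (fun x : Fin n → PlusMinus => ((x ⟨0, hn⟩).1 : ℝ) / 2) (1 / 2) (by norm_num)
        (fun x => (habs _).le) (by simp [habs])
      refine ⟨t, h0, h1.trans ?_, ht⟩
      have hs : √(n : ℝ) ≤ 4 := by
        rw [Real.sqrt_le_left (by norm_num)]
        norm_num
        exact_mod_cast (by omega : n ≤ 16)
      rw [le_div_iff₀ hpos]
      nlinarith [Real.pi_pos]

theorem exists_lipschitz_integral_cexp_eq_zero {n : ℕ} (hn : 1 ≤ n) :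
    ∃ φ : (Fin n → PlusMinus) → ℂ, HammingLipschitz φ ∧ ∀ k : ℕ, 1 ≤ k →
      ∃ z : ℂ, ‖z‖ ≤ 8 * Real.pi / ((k : ℝ) * √(n : ℝ)) ∧
        ∫ x, Complex.exp (z * ∑ _i : Fin k, φ x) ∂(cubeMeasure n) = 0 := by
  obtain ⟨g, hlip, hodd, t, h0, h1, ht⟩ := exists_real_lipschitz_sum_cos_eq_zero hn
  refine ⟨fun x => g x, fun x y => ?_, fun k hk => ⟨t * Complex.I / k, ?_, ?_⟩⟩
  · rw [← Complex.ofReal_sub, Complex.norm_real, Real.norm_eq_abs]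
    convert hlip x y
  · have hk' : (0 : ℝ) < k := by exact_mod_cast hk
    rw [norm_div, norm_mul, Complex.norm_I, Complex.norm_real, Complex.norm_natCast,
      Real.norm_of_nonneg h0, mul_one, mul_comm (k : ℝ), ← div_div]
    gcongr
  · have hk' : (k : ℂ) ≠ 0 := by exact_mod_cast (by omega : k ≠ 0)
    refine integral_cubeMeasure_eq_zero _ ?_
    let e : (Fin n → PlusMinus) ≃ (Fin n → PlusMinus) :=
      ⟨fun x i => (x i).neg, fun x i => (x i).neg, fun x => by simp [PlusMinus.neg_neg],
        fun x => by simp [PlusMinus.neg_neg]⟩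
    rw [← sum_cexp_I_mul_eq_zero_of_odd e g hodd t ht]
    refine Finset.sum_congr rfl fun x _ => ?_
    congr 1
    simp only [Finset.sum_const, Finset.card_univ, Fintype.card_fin, nsmul_eq_mul]
    field_simp

theorem mainTheorem3 :
    ∃ γ : ℝ, 0 < γ ∧
      (∃ N : ℕ, ∀ n : ℕ, N ≤ n → ∃ φ : (Fin n → PlusMinus) → ℂ,
        HammingLipschitz φ ∧
        (∃ z : ℂ, ‖z‖ ≤ γ / √(n : ℝ) ∧ ∫ x, Complex.exp (z * φ x) ∂(cubeMeasure n) = 0) ∧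
        ∀ k : ℕ, 1 ≤ k →
          IsAdmissible (fun _ : Fin k => φ) k n ∧
          ∃ z : ℂ, ‖z‖ ≤ γ / ((k : ℝ) * √(n : ℝ)) ∧
            ∫ x, Complex.exp (z * ∑ _i : Fin k, φ x) ∂(cubeMeasure n) = 0) ∧
      (∀ c r : ℕ, 1 ≤ c → 2 ≤ r →
        ¬ ZeroFreeRadius c r (γ / ((c : ℝ) * √((r : ℝ) - 1)))) := by
  refine ⟨8 * Real.pi, by positivity, ⟨1, fun n hn => ?_⟩, fun c r hc hr h => ?_⟩
  · obtain ⟨φ, hφ, hz⟩ := exists_lipschitz_integral_cexp_eq_zero hn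
    refine ⟨φ, hφ, ?_, fun k hk => ⟨isAdmissible_const hφ, hz k hk⟩⟩
    simpa using hz 1 le_rfl
  · obtain ⟨φ, hφ, hz⟩ := exists_lipschitz_integral_cexp_eq_zero (by omega : 1 ≤ r)
    obtain ⟨z, hz1, hz2⟩ := hz c hc
    have : MeasureTheory.IsProbabilityMeasure
        (ProbabilityTheory.uniformOn (Set.univ : Set PlusMinus)) :=
      ProbabilityTheory.isProbabilityMeasure_uniformOn Set.finite_univ
        ⟨⟨1, by simp⟩, Set.mem_univ _⟩
    refine h r c (fun _ => PlusMinus) (fun _ => ProbabilityTheory.uniformOn Set.univ)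
      (fun _ => φ) (isAdmissible_const hφ) z (hz1.trans ?_) hz2
    have hc' : (0 : ℝ) < c := by exact_mod_cast hc
    have hr' : (0 : ℝ) < (r : ℝ) - 1 := by
      have : (2 : ℝ) ≤ r := by exact_mod_cast hr
      linarith
    have := Real.pi_pos
    gcongr
    linarith
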